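/- Let $p>3$ be a prime, $k\ge 1$, $N=p^{2k}$, and write $\mathbb{Z}_n=\mathbb{Z}/n\mathbb{Z}$, $e(x)=e^{2\pi i x}$. Let $L^2(\mathbb{Z}_N)$ be the space of functions $\mathbb{Z}_N\to\mathbb{C}$ with $\langle\phi,\psi\rangle=\frac1N\sum_{Q\in\mathbb{Z}_N}\phi(Q)\overline{\psi(Q)}$, $\|\psi\|_2=\langle\psi,\psi\rangle^{1/2}$ and $\|\psi\|_\infty=\max_{x\in\mathbb{Z}_N}|\psi(x)|$. Let $U_N$ be the Weil representation of $SL(2,\mathbb{Z}_N)$ on $L^2(\mathbb{Z}_N)$, that is, the unique representation such that, with $r=2^{-1}\in\mathbb{Z}_N$, $$U_N\begin{pmatrix}1&b\\0&1\end{pmatrix}\psi(x)=e\Big(\frac{rbx^2}{N}\Big)\psi(x),\qquad U_N\begin{pmatrix}t&0\\0&t^{-1}\end{pmatrix}\psi(x)=\psi(tx),\qquad U_N\begin{pmatrix}0&1\\-1&0\end{pmatrix}\psi(x)=\frac1{\sqrt N}\sum_{y\in\mathbb{Z}_N}\psi(y)\,e\Big(\frac{2rxy}{N}\Big)$$ for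 all $b\in\mathbb{Z}_N$, $t\in\mathbb{Z}_N^\times$. For $D\in\mathbb{Z}_N$ let $$H_D=\left\{\begin{pmatrix}a&bD\\b&a\end{pmatrix}:\ a,b\in\mathbb{Z}_N,\ a^2-Db^2=1\right\}.$$ A Hecke eigenfunction is a nonzero $\psi\in L^2(\mathbb{Z}_N)$ that is an eigenfunction of $U_N(h)$ for every $h\in H_D$; it is normalized if $\|\psi\|_2=1$. For $x=(x_1,x_2)\in\mathbb{Z}_N^2$ put $\zeta_x=\sum_{t\in\mathbb{Z}_{p^k}}e(x_1t/p^k)\,\delta_{x_2+p^kt}$, where $\delta_y$ is the indicator function of $\{y\}$; up to a scalar of absolute value $1$, $\zeta_x$ depends only on $x$ modulo $p^k$. For $C\in\mathbb{Z}_{p^k}$ let $V_C$ be the span of all $\zeta_x$ with $x_1^2-Dx_2^2\equiv -C \pmod{p^k}$. **Theorem.** Assume that $p\mid D$ (the ramified case) and $C\in\mathbb{Z}_{p^k}^\times$. If $\psi\in V_C$ is a normalized Hecke eigenfunction, then $$\sqrt2\left(1-\frac{\pi^2}{8N}\right)\le\|\psi\|_\infty\le\sqrt2 .$$ -/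

import Mathlib

namespace QuantumCat

/-- The exponential `e(x / n) = exp (2 π i x / n)` for a residue class `x` modulo `n`. -/
noncomputable def e {n : ℕ} [NeZero n] (x : ZMod n) : ℂ := ZMod.stdAddChar x

/-- The modulus `N = p ^ (2 k)`. -/
abbrev modulus (p k : ℕ) : ℕ := p ^ (2 * k)

/-- The state space `L²(ℤ_N)`, `N = p ^ (2 k)`: all complex functions on `ℤ_N`. -/
abbrev State (p k : ℕ) : Type := ZMod (modulus p k) → ℂ

/-- The group `SL(2, ℤ_N)`, `N = p ^ (2 k)`. -/
abbrev SL2 (p k : ℕ) : Type := Matrix.SpecialLinearGroup (Fin 2) (ZMod (modulus p k))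

/-- The inner product `⟨φ, ψ⟩ = (1 / N) ∑ φ(Q) * conj ψ(Q)`. -/
noncomputable def l2Inner {n : ℕ} [NeZero n] (φ ψ : ZMod n → ℂ) : ℂ :=
  (1 / (n : ℂ)) * ∑ Q : ZMod n, φ Q * (starRingEnd ℂ) (ψ Q)

/-- The norm `‖ψ‖₂ = ⟨ψ, ψ⟩ ^ (1/2)`. -/
noncomputable def l2Norm {n : ℕ} [NeZero n] (ψ : ZMod n → ℂ) : ℝ :=
  Real.sqrt (l2Inner ψ ψ).re

/-- The supremum norm `‖ψ‖_∞ = sup |ψ(x)|` (over a finite non-empty set). -/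
noncomputable def supNorm {n : ℕ} (ψ : ZMod n → ℂ) : ℝ := ⨆ x : ZMod n, ‖ψ x‖

/-- The matrix `n_b = (1 b; 0 1)`. -/
def nMat {R : Type*} [CommRing R] (b : R) : Matrix.SpecialLinearGroup (Fin 2) R :=
  ⟨!![1, b; 0, 1], by simp [Matrix.det_fin_two_of]⟩

/-- The matrix `a_t = (t 0; 0 t⁻¹)`. -/
def aMat {R : Type*} [CommRing R] (t : Rˣ) : Matrix.SpecialLinearGroup (Fin 2) R :=
  ⟨!![(t : R), 0; 0, ((t⁻¹ : Rˣ) : R)], by simp [Matrix.det_fin_two_of]⟩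

/-- The matrix `ω = (0 1; -1 0)`. -/
def wMat {R : Type*} [CommRing R] : Matrix.SpecialLinearGroup (Fin 2) R :=
  ⟨!![0, 1; -1, 0], by simp [Matrix.det_fin_two_of]⟩

/-- `U` is the Weil representation of `SL(2, ℤ_N)` on `L²(ℤ_N)`, `N = p ^ (2 k)` with `p` odd:
on generators
`U(n_b) ψ (x) = e(r b x² / N) ψ(x)`, `U(a_t) ψ (x) = Λ(t) ψ(t x)`,
`U(ω) ψ (x) = S / √N * ∑_y ψ(y) e(2 r x y / N)`.
As `N` is an odd square, the constants are `Λ(t) = 1`, `S = 1`, and `r` is the inverse of `2`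
in `ℤ_N`. -/
structure IsWeilRep (p k : ℕ) [Fact p.Prime] (U : Representation ℂ (SL2 p k) (State p k)) :
    Prop where
  nMat_apply : ∀ (b : ZMod (modulus p k)) (ψ : State p k) (x : ZMod (modulus p k)),
    U (nMat b) ψ x = e ((2 : ZMod (modulus p k))⁻¹ * b * x ^ 2) * ψ x
  aMat_apply : ∀ (t : (ZMod (modulus p k))ˣ) (ψ : State p k) (x : ZMod (modulus p k)),
    U (aMat t) ψ x = ψ (t * x)
  wMat_apply : ∀ (ψ : State p k) (x : ZMod (modulus p k)),
    U wMat ψ x = (1 / (Real.sqrt (modulus p k : ℝ) : ℂ)) *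
      ∑ y : ZMod (modulus p k), ψ y * e (2 * (2 : ZMod (modulus p k))⁻¹ * x * y)

section existence

/-- In `ℤ_N`, `N` a prime power, an element is a unit or a multiple of the prime. -/
theorem isUnit_or_dvd (p k : ℕ) [hp : Fact p.Prime] (a : ZMod (modulus p k)) :
    IsUnit a ∨ (p : ZMod (modulus p k)) ∣ a := by
  by_cases h : p ∣ a.val
  · right
    rw [← ZMod.natCast_zmod_val a]
    exact_mod_cast Nat.cast_dvd_cast h
  · left
    rw [← ZMod.natCast_zmod_val a, ZMod.isUnit_iff_coprime]
    exact (((Nat.Prime.coprime_iff_not_dvd hp.out).2 h).symm).pow_right _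

/-- The first column of a matrix of determinant one has a unit entry. -/
theorem isUnit_col (p k : ℕ) [hp : Fact p.Prime] (B : SL2 p k) :
    IsUnit (B.1 1 0) ∨ IsUnit (B.1 0 0) := by
  rcases isUnit_or_dvd p k (B.1 1 0) with h | ⟨c, hc⟩
  · exact Or.inl h
  rcases isUnit_or_dvd p k (B.1 0 0) with h | ⟨a, ha⟩
  · exact Or.inr h
  left
  have hdet := B.2
  rw [Matrix.det_fin_two, ha, hc] at hdet
  have hpu : IsUnit (p : ZMod (modulus p k)) :=
    IsUnit.of_mul_eq_one (a * B.1 1 1 - B.1 0 1 * c) (by linear_combination hdet)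
  have hnil : (p : ZMod (modulus p k)) ^ (2 * k) = 0 := by
    exact_mod_cast ZMod.natCast_self (p ^ (2 * k))
  have h0 : IsUnit (0 : ZMod (modulus p k)) := hnil ▸ hpu.pow _
  have := isUnit_zero_iff.1 h0
  have hs : Subsingleton (ZMod (modulus p k)) := subsingleton_of_zero_eq_one this
  exact isUnit_of_subsingleton _

/-- Bruhat decomposition of a matrix whose lower left entry is a unit. -/
theorem eq_mul_of_isUnit {R : Type*} [CommRing R] (B : Matrix.SpecialLinearGroup (Fin 2) R)
    (u : Rˣ) (hu : (u : R) = B.1 1 0) :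
    B = nMat (B.1 0 0 * ((u⁻¹ : Rˣ) : R)) * wMat * nMat (B.1 1 0 * B.1 1 1) * aMat (-u) := by
  have hdet := B.2
  rw [Matrix.det_fin_two] at hdet
  have h1 : (u : R) * ((u⁻¹ : Rˣ) : R) = 1 := by simp
  apply Subtype.ext
  ext i j
  rw [Matrix.SpecialLinearGroup.coe_mul, Matrix.SpecialLinearGroup.coe_mul,
    Matrix.SpecialLinearGroup.coe_mul]
  fin_cases i <;> fin_cases j <;>
    simp only [nMat, wMat, aMat, Matrix.mul_apply, Fin.sum_univ_two, Matrix.of_apply,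
      Matrix.cons_val', Matrix.cons_val_zero, Matrix.cons_val_one, Matrix.cons_val_fin_one,
      Fin.zero_eta, Fin.mk_one, Units.val_neg, inv_neg, ← hu]
  · linear_combination -(B.1 0 0) * h1
  · rw [← hu] at hdet
    linear_combination -(B.1 0 1) * h1 - ((u⁻¹ : Rˣ) : R) * hdet
      - B.1 0 0 * B.1 1 1 * ((u⁻¹ : Rˣ) : R) * h1
  · ring
  · linear_combination -(B.1 1 1) * h1

/-- `SL(2, ℤ_N)` is generated, as a monoid, by the `n_b`, `a_t` and `ω`. -/
theorem gen_induction (p k : ℕ) [Fact p.Prime] {P : SL2 p k → Prop}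
    (hn : ∀ b, P (nMat b)) (ha : ∀ t, P (aMat t)) (hw : P wMat)
    (hmul : ∀ A B, P A → P B → P (A * B)) (B : SL2 p k) : P B := by
  have key : ∀ B : SL2 p k, IsUnit (B.1 1 0) → P B := by
    rintro B ⟨u, hu⟩
    rw [eq_mul_of_isUnit B u hu]
    exact hmul _ _ (hmul _ _ (hmul _ _ (hn _) hw) (hn _)) (ha _)
  rcases isUnit_col p k B with h | h
  · exact key B h
  · have h2 : P (wMat * B) := by
      apply key
      rw [Matrix.SpecialLinearGroup.coe_mul]
      simpa [wMat, Matrix.mul_apply, Fin.sum_univ_two] using h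
    have h3 : B = wMat * wMat * wMat * (wMat * B) := by
      apply Subtype.ext
      ext i j
      simp only [Matrix.SpecialLinearGroup.coe_mul]
      fin_cases i <;> fin_cases j <;>
        simp only [wMat, Matrix.mul_apply, Fin.sum_univ_two, Matrix.of_apply, Matrix.cons_val',
          Matrix.cons_val_zero, Matrix.cons_val_one, Matrix.cons_val_fin_one, Fin.zero_eta,
          Fin.mk_one] <;>
        ring
    rw [h3]
    exact hmul _ _ (hmul _ _ (hmul _ _ hw hw) hw) h2

open Classical in
/-- Auxiliary family of functions permuted by the Weil representation. -/
noncomputable def eta (p k : ℕ) [Fact p.Prime] (x : Fin 2 → ZMod (modulus p k)) : State p k :=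
  fun z => if (p : ZMod (modulus p k)) ^ k ∣ z - x 1 then
    e (x 0 * z - (2 : ZMod (modulus p k))⁻¹ * x 0 * x 1) else 0

theorem e_add {n : ℕ} [NeZero n] (x y : ZMod n) : e (x + y) = e x * e y :=
  AddChar.map_add_eq_mul _ _ _

theorem e_zero {n : ℕ} [NeZero n] : e (0 : ZMod n) = 1 := AddChar.map_zero_eq_one _

theorem pk_sq (p k : ℕ) :
    (p : ZMod (modulus p k)) ^ k * (p : ZMod (modulus p k)) ^ k = 0 := by
  rw [← pow_add, ← two_mul]
  exact_mod_cast ZMod.natCast_self (p ^ (2 * k))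

theorem pk_dvd_of_mul (p k : ℕ) [hp : Fact p.Prime] (w : ZMod (modulus p k))
    (h : w * (p : ZMod (modulus p k)) ^ k = 0) : (p : ZMod (modulus p k)) ^ k ∣ w := by
  have h1 : ((w.val * p ^ k : ℕ) : ZMod (modulus p k)) = 0 := by
    push_cast
    rw [ZMod.natCast_zmod_val]; exact h
  rw [ZMod.natCast_eq_zero_iff] at h1
  have hm : modulus p k = p ^ k * p ^ k := by rw [← pow_add, ← two_mul]
  have h2 : p ^ k ∣ w.val :=
    Nat.dvd_of_mul_dvd_mul_right (pow_pos hp.out.pos k) (hm.symm.dvd.trans h1)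
  rw [← ZMod.natCast_zmod_val w]
  exact_mod_cast Nat.cast_dvd_cast (α := ZMod (modulus p k)) h2

open Classical in
theorem card_mult (p k : ℕ) [hp : Fact p.Prime] (c : ZMod (modulus p k)) :
    (∑ y : ZMod (modulus p k), if (p : ZMod (modulus p k)) ^ k ∣ y - c then (1 : ℂ) else 0)
      = (p : ℂ) ^ k := by
  rw [Finset.sum_boole]
  have h : (Finset.range (p ^ k)).card = (Finset.univ.filter fun y : ZMod (modulus p k) =>
      (p : ZMod (modulus p k)) ^ k ∣ y - c).card := by
    refine Finset.card_bij (fun i _ => c + (p : ZMod (modulus p k)) ^ k * (i : ℕ)) ?_ ?_ ?_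
    · intro i _
      simp
    · intro i hi j hj hij
      have h1 : ((p ^ k * i : ℕ) : ZMod (modulus p k)) = ((p ^ k * j : ℕ) : ZMod (modulus p k)) := by
        push_cast
        exact add_left_cancel hij
      have hlt : ∀ i ∈ Finset.range (p ^ k), p ^ k * i < modulus p k := by
        intro i hi
        rw [show modulus p k = p ^ k * p ^ k by rw [← pow_add, ← two_mul]]
        exact Nat.mul_lt_mul_of_pos_left (Finset.mem_range.1 hi) (pow_pos hp.out.pos k)
      rw [ZMod.natCast_eq_natCast_iff', Nat.mod_eq_of_lt (hlt i hi),
        Nat.mod_eq_of_lt (hlt j hj)] at h1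
      exact Nat.eq_of_mul_eq_mul_left (pow_pos hp.out.pos k) h1
    · intro y hy
      obtain ⟨t, ht⟩ := (Finset.mem_filter.1 hy).2
      refine ⟨t.val % p ^ k, Finset.mem_range.2 (Nat.mod_lt _ (pow_pos hp.out.pos k)), ?_⟩
      have h1 : t = (p : ZMod (modulus p k)) ^ k * ((t.val / p ^ k : ℕ) : ZMod (modulus p k)) +
          ((t.val % p ^ k : ℕ) : ZMod (modulus p k)) := by
        conv_lhs => rw [← ZMod.natCast_zmod_val t, ← Nat.div_add_mod t.val (p ^ k)]
        push_cast
        rfl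
      linear_combination -ht - (p : ZMod (modulus p k)) ^ k * h1 +
        -((t.val / p ^ k : ℕ) : ZMod (modulus p k)) * pk_sq p k
  rw [← h]
  simp

open Classical in
theorem char_sum (p k : ℕ) [hp : Fact p.Prime] (c w : ZMod (modulus p k)) :
    (∑ y : ZMod (modulus p k), if (p : ZMod (modulus p k)) ^ k ∣ y - c then e (w * y) else 0)
      = if (p : ZMod (modulus p k)) ^ k ∣ w then (p : ℂ) ^ k * e (w * c) else 0 := by
  split_ifs with hw
  · obtain ⟨v, rfl⟩ := hw
    rw [← card_mult p k c, Finset.sum_mul]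
    refine Finset.sum_congr rfl fun y _ => ?_
    split_ifs with hy
    · obtain ⟨t, ht⟩ := hy
      rw [one_mul]
      congr 1
      linear_combination (p : ZMod (modulus p k)) ^ k * v * ht + v * t * pk_sq p k
    · simp
  · set S := ∑ y : ZMod (modulus p k),
      if (p : ZMod (modulus p k)) ^ k ∣ y - c then e (w * y) else 0 with hS
    have h1 : S = e (w * (p : ZMod (modulus p k)) ^ k) * S := by
      conv_lhs => rw [hS, ← Equiv.sum_comp (Equiv.addRight ((p : ZMod (modulus p k)) ^ k))]
      rw [hS, Finset.mul_sum]
      refine Finset.sum_congr rfl fun y _ => ?_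
      have : (p : ZMod (modulus p k)) ^ k ∣ y + (p : ZMod (modulus p k)) ^ k - c ↔
          (p : ZMod (modulus p k)) ^ k ∣ y - c := by
        rw [show y + (p : ZMod (modulus p k)) ^ k - c
          = (y - c) + (p : ZMod (modulus p k)) ^ k by ring]
        exact dvd_add_self_right
      simp only [Equiv.coe_addRight, this]
      split_ifs
      · rw [← e_add]; congr 1; ring
      · simp
    by_contra hne
    have h2 : e (w * (p : ZMod (modulus p k)) ^ k) = 1 := by
      have := mul_right_cancel₀ hne ((one_mul S).trans h1)
      exact this.symm
    rw [← e_zero (n := modulus p k)] at h2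
    exact hw (pk_dvd_of_mul p k w (ZMod.injective_stdAddChar h2))

theorem two_mul_inv (p k : ℕ) [hp : Fact p.Prime] (h3 : 3 < p) :
    (2 : ZMod (modulus p k)) * (2 : ZMod (modulus p k))⁻¹ = 1 := by
  have h : Nat.Coprime 2 (modulus p k) := by
    apply Nat.Coprime.pow_right
    rw [Nat.coprime_primes Nat.prime_two hp.out]; omega
  exact_mod_cast ZMod.coe_mul_inv_eq_one 2 h

/-- The function `eta` is a delta function up to averaging. -/
theorem sum_eta (p k : ℕ) [hp : Fact p.Prime] (w : ZMod (modulus p k)) :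
    (Pi.single w 1 : State p k) = ∑ x : ZMod (modulus p k),
      ((1 / (modulus p k : ℂ)) * e (-x * w + (2 : ZMod (modulus p k))⁻¹ * x * w)) •
        eta p k ![x, w] := by
  ext z
  have hsum := AddChar.sum_mulShift (z - w) (ZMod.isPrimitive_stdAddChar (modulus p k))
  rw [ZMod.card] at hsum
  have hterm : ∀ x : ZMod (modulus p k),
      (((1 / (modulus p k : ℂ)) * e (-x * w + (2 : ZMod (modulus p k))⁻¹ * x * w)) •
        eta p k ![x, w]) z = (1 / (modulus p k : ℂ)) *
        (open Classical in if (p : ZMod (modulus p k)) ^ k ∣ z - w then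
          (ZMod.stdAddChar (x * (z - w)) : ℂ) else 0) := by
    intro x
    simp only [Pi.smul_apply, smul_eq_mul, eta, Matrix.cons_val_zero, Matrix.cons_val_one,
      Matrix.cons_val_fin_one]
    split_ifs
    · rw [mul_assoc, ← e_add, e]
      congr 2
      ring
    · simp
  rw [Finset.sum_apply, Finset.sum_congr rfl fun x _ => hterm x, ← Finset.mul_sum]
  by_cases hz : z = w
  · subst hz
    simp
  · rw [Pi.single_eq_of_ne hz]
    split_ifs
    · rw [hsum, if_neg (sub_ne_zero.2 hz)]; simp
    · simp

/-- The operator of multiplication by a quadratic character. -/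
noncomputable def opN (p k : ℕ) [Fact p.Prime] (b : ZMod (modulus p k)) :
    State p k →ₗ[ℂ] State p k where
  toFun ψ x := e ((2 : ZMod (modulus p k))⁻¹ * b * x ^ 2) * ψ x
  map_add' φ ψ := by ext x; simp [mul_add]
  map_smul' c ψ := by ext x; simp; ring

/-- The dilation operator. -/
noncomputable def opA (p k : ℕ) [Fact p.Prime] (t : (ZMod (modulus p k))ˣ) :
    State p k →ₗ[ℂ] State p k where
  toFun ψ x := ψ (t * x)
  map_add' φ ψ := by ext x; simp
  map_smul' c ψ := by ext x; simp

/-- The Fourier operator. -/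
noncomputable def opW (p k : ℕ) [Fact p.Prime] : State p k →ₗ[ℂ] State p k where
  toFun ψ x := (1 / (Real.sqrt (modulus p k : ℝ) : ℂ)) *
      ∑ y : ZMod (modulus p k), ψ y * e (2 * (2 : ZMod (modulus p k))⁻¹ * x * y)
  map_add' φ ψ := by ext x; simp [add_mul, Finset.sum_add_distrib, mul_add]
  map_smul' c ψ := by
    ext x; simp only [Pi.smul_apply, smul_eq_mul, RingHom.id_apply, mul_assoc, ← Finset.mul_sum]
    ring

/-- `T` acts on the family `eta` as `B` acts on vectors. -/
def Moves (p k : ℕ) [Fact p.Prime] (B : SL2 p k) (T : State p k →ₗ[ℂ] State p k) : Prop :=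
  ∀ x, T (eta p k x) = eta p k (B.1.mulVec x)

theorem moves_n (p k : ℕ) [Fact p.Prime] (h3 : 3 < p) (b : ZMod (modulus p k)) :
    Moves p k (nMat b) (opN p k b) := by
  intro x
  ext z
  have h2 := two_mul_inv p k h3
  simp only [opN, eta, LinearMap.coe_mk, AddHom.coe_mk, nMat, Matrix.mulVec, dotProduct,
    Fin.sum_univ_two]
  simp only [Matrix.of_apply, Matrix.cons_val', Matrix.cons_val_zero, Matrix.cons_val_one,
    Matrix.cons_val_fin_one, one_mul, zero_mul, zero_add]
  split_ifs with hz
  · obtain ⟨t, ht⟩ := hz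
    rw [← e_add]; congr 1
    have hs := pk_sq p k
    set M := (p : ZMod (modulus p k)) ^ k
    set r := (2 : ZMod (modulus p k))⁻¹
    have hz : z = x 1 + M * t := by linear_combination ht
    subst hz
    linear_combination (b * x 1 ^ 2 + b * x 1 * M * t) * h2 + r * b * t ^ 2 * hs
  · simp

theorem moves_a (p k : ℕ) [Fact p.Prime] (t : (ZMod (modulus p k))ˣ) :
    Moves p k (aMat t) (opA p k t) := by
  intro x
  ext z
  simp only [opA, eta, LinearMap.coe_mk, AddHom.coe_mk, aMat, Matrix.mulVec, dotProduct,
    Fin.sum_univ_two]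
  simp only [Matrix.of_apply, Matrix.cons_val', Matrix.cons_val_zero, Matrix.cons_val_one,
    Matrix.cons_val_fin_one, zero_mul, zero_add, add_zero]
  have h1 : (t : ZMod (modulus p k)) * ((t⁻¹ : (ZMod (modulus p k))ˣ) : ZMod (modulus p k)) = 1 :=
    by simp
  have : (p : ZMod (modulus p k)) ^ k ∣ t * z - x 1 ↔
      (p : ZMod (modulus p k)) ^ k ∣ z - ((t⁻¹ : (ZMod (modulus p k))ˣ) : ZMod (modulus p k)) * x 1
      := by
    rw [← Units.dvd_mul_left (u := t)
      (b := z - ((t⁻¹ : (ZMod (modulus p k))ˣ) : ZMod (modulus p k)) * x 1)]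
    rw [show (t : ZMod (modulus p k)) *
      (z - ((t⁻¹ : (ZMod (modulus p k))ˣ) : ZMod (modulus p k)) * x 1) = t * z - x 1 by
      linear_combination -x 1 * h1]
  simp only [this]
  split_ifs
  · congr 1
    linear_combination -(2 : ZMod (modulus p k))⁻¹ * x 0 * x 1 * h1 * (-1)
  · rfl

theorem moves_w (p k : ℕ) [hp : Fact p.Prime] (h3 : 3 < p) :
    Moves p k wMat (opW p k) := by
  intro x
  ext z
  have h2 := two_mul_inv p k h3
  have hsq : (Real.sqrt (modulus p k : ℝ) : ℂ) = (p : ℂ) ^ k := by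
    have : Real.sqrt (modulus p k : ℝ) = (p : ℝ) ^ k := by
      rw [Real.sqrt_eq_iff_mul_self_eq (by positivity) (by positivity)]
      push_cast [modulus]
      ring
    rw [this]; push_cast; rfl
  have hp0 : (p : ℂ) ^ k ≠ 0 := pow_ne_zero _ (by exact_mod_cast hp.out.ne_zero)
  simp only [opW, LinearMap.coe_mk, AddHom.coe_mk, hsq, h2, one_mul]
  have : ∀ y, eta p k x y * e (z * y) = e (-((2 : ZMod (modulus p k))⁻¹ * x 0 * x 1)) *
      (open Classical in if (p : ZMod (modulus p k)) ^ k ∣ y - x 1 then e ((x 0 + z) * y) else 0) := by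
    intro y
    simp only [eta]
    split_ifs
    · rw [← e_add, ← e_add]; congr 1; ring
    · simp
  simp only [this, ← Finset.mul_sum, char_sum]
  simp only [eta, wMat, Matrix.mulVec, dotProduct, Fin.sum_univ_two]
  simp only [Matrix.of_apply, Matrix.cons_val', Matrix.cons_val_zero, Matrix.cons_val_one,
    Matrix.cons_val_fin_one, one_mul, zero_mul, zero_add, add_zero]
  rw [show z - -1 * x 0 = x 0 + z by ring]
  split_ifs
  · have he : e (-((2 : ZMod (modulus p k))⁻¹ * x 0 * x 1)) * e ((x 0 + z) * x 1) =
        e (x 1 * z - (2 : ZMod (modulus p k))⁻¹ * x 1 * (-1 * x 0)) := by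
      rw [← e_add]; congr 1
      linear_combination -(x 0 * x 1) * h2
    rw [← he]
    field_simp
  · simp

/-- An operator is determined by its values on the family `eta`. -/
theorem moves_unique (p k : ℕ) [Fact p.Prime] {B : SL2 p k} {S T : State p k →ₗ[ℂ] State p k}
    (hS : Moves p k B S) (hT : Moves p k B T) : S = T := by
  refine LinearMap.pi_ext' fun w => LinearMap.ext_ring ?_
  simp only [LinearMap.comp_apply, LinearMap.single_apply]
  rw [sum_eta p k w, map_sum, map_sum]
  refine Finset.sum_congr rfl fun x _ => ?_
  rw [map_smul, map_smul, hS, hT]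

theorem moves_mul (p k : ℕ) [Fact p.Prime] {A B : SL2 p k} {S T : State p k →ₗ[ℂ] State p k}
    (hS : Moves p k A S) (hT : Moves p k B T) : Moves p k (A * B) (S * T) := by
  intro x
  rw [Module.End.mul_apply, hT, hS, Matrix.SpecialLinearGroup.coe_mul, Matrix.mulVec_mulVec]

/-- The three formulas on the generators define exactly one representation. -/
theorem existsUnique_isWeilRep (p k : ℕ) [Fact p.Prime] (h3 : 3 < p) :
    ∃! U : Representation ℂ (SL2 p k) (State p k), IsWeilRep p k U := by
  have hex : ∀ B : SL2 p k, ∃ T, Moves p k B T := by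
    refine gen_induction p k (fun b => ⟨_, moves_n p k h3 b⟩) (fun t => ⟨_, moves_a p k t⟩)
      ⟨_, moves_w p k h3⟩ ?_
    rintro A B ⟨S, hS⟩ ⟨T, hT⟩
    exact ⟨S * T, moves_mul p k hS hT⟩
  choose T hT using hex
  refine ⟨⟨⟨T, ?_⟩, ?_⟩, ⟨?_, ?_, ?_⟩, ?_⟩
  · refine moves_unique p k (hT 1) fun x => ?_
    simp
  · intro A B
    exact moves_unique p k (hT _) (moves_mul p k (hT A) (hT B))
  · intro b ψ x
    exact congrFun (LinearMap.congr_fun (moves_unique p k (hT _) (moves_n p k h3 b)) ψ) x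
  · intro t ψ x
    exact congrFun (LinearMap.congr_fun (moves_unique p k (hT _) (moves_a p k t)) ψ) x
  · intro ψ x
    exact congrFun (LinearMap.congr_fun (moves_unique p k (hT _) (moves_w p k h3)) ψ) x
  · intro V hV
    ext1 B
    change V B = T B
    refine moves_unique p k ?_ (hT B)
    refine gen_induction p k (P := fun B => Moves p k B (V B)) ?_ ?_ ?_ ?_ B
    · intro b x
      rw [← moves_n p k h3 b x]
      ext z
      exact hV.nMat_apply b _ z
    · intro t x
      rw [← moves_a p k t x]
      ext z
      exact hV.aMat_apply t _ z
    · intro x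
      rw [← moves_w p k h3 x]
      ext z
      exact hV.wMat_apply _ z
    · intro A B hA hB
      rw [map_mul]
      exact moves_mul p k hA hB

end existence

/-- The Weil representation `B ↦ U_N(B)` of `SL(2, ℤ_N)` on `L²(ℤ_N)`, `N = p ^ (2 k)`, `p > 3`:
the unique representation given by the formulas of `IsWeilRep` on the generators. -/
noncomputable def weilRep (p k : ℕ) [Fact p.Prime] (h3 : 3 < p) :
    Representation ℂ (SL2 p k) (State p k) :=
  (existsUnique_isWeilRep p k h3).choose

theorem weilRep_spec (p k : ℕ) [Fact p.Prime] (h3 : 3 < p) : IsWeilRep p k (weilRep p k h3) :=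
  (existsUnique_isWeilRep p k h3).choose_spec.1

/-- `H_D = {(a, b D; b, a) : a² - D b² = 1}` in `SL(2, ℤ_N)`. -/
def heckeGroup (p k : ℕ) (D : ZMod (modulus p k)) : Set (SL2 p k) :=
  {g | ∃ a b : ZMod (modulus p k), a ^ 2 - D * b ^ 2 = 1 ∧ g.1 = !![a, b * D; b, a]}

/-- A Hecke eigenfunction: a non-zero joint eigenfunction of all `U_N(h)`, `h ∈ H_D`. -/
def IsHeckeEigenfunction (p k : ℕ) [Fact p.Prime] (h3 : 3 < p) (D : ZMod (modulus p k))
    (ψ : State p k) : Prop :=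
  ψ ≠ 0 ∧ ∀ h ∈ heckeGroup p k D, ∃ μ : ℂ, weilRep p k h3 h ψ = μ • ψ

/-- Reduction `ℤ_N → ℤ_{p^k}`, `N = p ^ (2 k)`. -/
def red (p k : ℕ) : ZMod (modulus p k) →+* ZMod (p ^ k) :=
  ZMod.castHom (pow_dvd_pow p (Nat.le_mul_of_pos_left k two_pos)) (ZMod (p ^ k))

/-- `ζ_x = ∑_{t ∈ ℤ_{p^k}} e(x₁ t / p^k) δ_{x₂ + p^k t}` for `x = (x₁, x₂) ∈ ℤ_N²`
(the components are `x 0` and `x 1`). -/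
noncomputable def zeta (p k : ℕ) [Fact p.Prime] (x : Fin 2 → ZMod (modulus p k)) : State p k :=
  ∑ t : ZMod (p ^ k), e (red p k (x 0) * t) •
    (Pi.single (x 1 + (p : ZMod (modulus p k)) ^ k * (t.val : ZMod (modulus p k))) 1 : State p k)

/-- The form `𝒩(x) = x₁² - D x₂²` on `ℤ_{p^k}²`. -/
def normForm (p k : ℕ) (D : ZMod (modulus p k)) (x : Fin 2 → ZMod (p ^ k)) : ZMod (p ^ k) :=
  x 0 ^ 2 - red p k D * x 1 ^ 2

/-- `V_C`: the span of the lines `ℂ ζ_x` with `𝒩(x) = -C` in `ℤ_{p^k}`. The line `ℂ ζ_x` depends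
only on `x` modulo `p^k`, so all lifts of `x` to `ℤ_N²` are allowed. -/
noncomputable def VC (p k : ℕ) [Fact p.Prime] (D : ZMod (modulus p k)) (C : ZMod (p ^ k)) :
    Submodule ℂ (State p k) :=
  Submodule.span ℂ
    {f | ∃ x : Fin 2 → ZMod (modulus p k), normForm p k D (fun i => red p k (x i)) = -C ∧
      f = zeta p k x}

end QuantumCat

namespace QuantumCat

/-! On a coset `z + p^k ℤ_N` only the `ζ_x` with `x₂ ≡ z` mod `p^k` are nonzero, and for those in
`V_C` the congruence `x₁² ≡ D z² - C` has, once it has a unit root `s`, only the roots `±s`. Hence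
on this coset `ψ(y) = u e(s y / N) + v e(-s y / N)` (`exists_two_waves`).

The two waves are orthogonal on the coset, so `|u|` and `|v|` can be read off by pairing `ψ` with
the functions `eta` at `(s, z)` and `(-s, z)` (`norm_etaCoeff`). The Weil representation is unitary
and sends `eta x` to `eta (g x)`; `H_D` is transitive on vectors of a given unit norm in `ℤ_N`, and
its eigenvalues have modulus one. So every amplitude is the same number `γ` (`norm_etaCoeff_eq`).
Ramification enters here: as `p ∣ D`, changing `z` changes the required `s²` only by a multiple of
`p`, so a root exists for every `z` and no coset is left out.

Normalization then gives `2γ² = 1`, and the triangle inequality gives `|ψ| ≤ 2γ = √2`. Conversely,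
along the coset of `0` the phase quotient of the two waves is rotated through all `p^k`-th roots of
unity, so at some point the waves are aligned up to an angle `π / p^k`. There `|ψ| ≥ 2γ cos(π / (2
p^k))`, which is at least the stated bound because `p^(2k) = N`. -/

theorem e_neg {n : ℕ} [NeZero n] (x : ZMod n) : e (-x) = (starRingEnd ℂ) (e x) :=
  AddChar.map_neg_eq_conj _ _

theorem norm_e {n : ℕ} [NeZero n] (x : ZMod n) : ‖e x‖ = 1 :=
  AddChar.norm_apply _ _

theorem e_mul_conj {n : ℕ} [NeZero n] (x : ZMod n) : e x * (starRingEnd ℂ) (e x) = 1 := by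
  rw [← e_neg, ← e_add, add_neg_cancel, e_zero]

theorem sum_e_mul {n : ℕ} [NeZero n] (a : ZMod n) :
    ∑ x : ZMod n, e (x * a) = if a = 0 then (n : ℂ) else 0 := by
  have h := AddChar.sum_mulShift a (ZMod.isPrimitive_stdAddChar n)
  rw [ZMod.card] at h
  simpa [e] using h

variable {p k : ℕ} [hp : Fact p.Prime]

/-! ### Reduction modulo `p^k` and the pointwise form of `ζ_x` -/

theorem red_natCast_val (t : ZMod (p ^ k)) : red p k (t.val : ZMod (modulus p k)) = t := by
  rw [map_natCast, ZMod.natCast_zmod_val]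

theorem red_eq_zero_iff (a : ZMod (modulus p k)) :
    red p k a = 0 ↔ (p : ZMod (modulus p k)) ^ k ∣ a := by
  constructor
  · intro h
    rw [← ZMod.natCast_zmod_val a, map_natCast, ZMod.natCast_eq_zero_iff] at h
    rw [← ZMod.natCast_zmod_val a]
    exact_mod_cast Nat.cast_dvd_cast (α := ZMod (modulus p k)) h
  · rintro ⟨c, rfl⟩
    have : ((p : ZMod (p ^ k))) ^ k = 0 := by exact_mod_cast ZMod.natCast_self (p ^ k)
    rw [map_mul, map_pow, map_natCast, this, zero_mul]

theorem pk_mul_eq_zero_iff (a : ZMod (modulus p k)) :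
    (p : ZMod (modulus p k)) ^ k * a = 0 ↔ (p : ZMod (modulus p k)) ^ k ∣ a := by
  constructor
  · intro h
    exact pk_dvd_of_mul p k a (by rw [mul_comm]; exact h)
  · rintro ⟨c, rfl⟩
    rw [← mul_assoc, pk_sq, zero_mul]

/-- Multiplication by `p^k` sees only residues modulo `p^k`, so the choice of representative `val`
in `zeta` is harmless. -/
theorem pk_mul_val_red (c : ZMod (modulus p k)) :
    (p : ZMod (modulus p k)) ^ k * ((red p k c).val : ZMod (modulus p k)) =
      (p : ZMod (modulus p k)) ^ k * c := by
  rw [← sub_eq_zero, ← mul_sub, pk_mul_eq_zero_iff, ← red_eq_zero_iff, map_sub,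
    red_natCast_val, sub_self]

theorem e_pk_mul_natCast (j : ℕ) :
    e ((p : ZMod (modulus p k)) ^ k * (j : ZMod (modulus p k))) = e (j : ZMod (p ^ k)) := by
  have h1 := ZMod.stdAddChar_coe (N := modulus p k) ((p ^ k * j : ℕ) : ℤ)
  have h2 := ZMod.stdAddChar_coe (N := p ^ k) (j : ℤ)
  have hp0 : (p : ℂ) ^ k ≠ 0 := pow_ne_zero _ (by exact_mod_cast hp.out.ne_zero)
  have h3 : (modulus p k : ℂ) = (p : ℂ) ^ k * (p : ℂ) ^ k := by
    push_cast [modulus]; ring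
  rw [h3] at h1
  push_cast at h1 h2
  rw [e, e, h1, h2]
  congr 1
  field_simp

theorem e_pk_mul (c : ZMod (modulus p k)) :
    e ((p : ZMod (modulus p k)) ^ k * c) = e (red p k c) := by
  conv_lhs => rw [← ZMod.natCast_zmod_val c]
  rw [e_pk_mul_natCast]
  conv_rhs => rw [← ZMod.natCast_zmod_val c, map_natCast]

open Classical in
-- At `z = x₂ + p^k t` the phase `x₁ t / p^k` equals `x₁ (z - x₂) / N`. Thus `ζ_x` is a plane wave
-- modulo `N` cut off to a coset, and differs from `eta x` only by a constant phase.
theorem zeta_apply (x : Fin 2 → ZMod (modulus p k)) (z : ZMod (modulus p k)) :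
    zeta p k x z =
      if (p : ZMod (modulus p k)) ^ k ∣ z - x 1 then e (x 0 * (z - x 1)) else 0 := by
  simp only [zeta, Finset.sum_apply, Pi.smul_apply, smul_eq_mul]
  split_ifs with h
  · obtain ⟨c, hc⟩ := h
    rw [Finset.sum_eq_single (red p k c)]
    · have : x 1 + (p : ZMod (modulus p k)) ^ k * ((red p k c).val : ZMod (modulus p k)) = z := by
        rw [pk_mul_val_red, ← hc]; ring
      rw [this, Pi.single_eq_same, mul_one, ← map_mul, ← e_pk_mul, hc]
      congr 1; ring
    · intro t _ ht
      rw [Pi.single_eq_of_ne, mul_zero]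
      rintro rfl
      apply ht
      have h1 : (p : ZMod (modulus p k)) ^ k * ((t.val : ZMod (modulus p k)) - c) = 0 := by
        linear_combination hc
      rw [pk_mul_eq_zero_iff, ← red_eq_zero_iff, map_sub, red_natCast_val, sub_eq_zero] at h1
      exact h1
    · simp
  · refine Finset.sum_eq_zero fun t _ => ?_
    rw [Pi.single_eq_of_ne, mul_zero]
    rintro rfl
    exact h ⟨(t.val : ZMod (modulus p k)), by ring⟩

/-! ### Units and square roots modulo `p^(2k)` -/

theorem not_isUnit_p (hk : 1 ≤ k) : ¬ IsUnit (p : ZMod (modulus p k)) := by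
  rw [ZMod.isUnit_iff_coprime]
  intro h
  have := Nat.Coprime.coprime_dvd_right (dvd_pow_self p (by omega : 2 * k ≠ 0)) h
  rw [Nat.coprime_self] at this
  exact hp.out.one_lt.ne' this

theorem isUnit_iff_not_dvd (hk : 1 ≤ k) (a : ZMod (modulus p k)) :
    IsUnit a ↔ ¬ (p : ZMod (modulus p k)) ∣ a :=
  ⟨fun h hd => not_isUnit_p hk (isUnit_of_dvd_unit hd h),
    fun h => (isUnit_or_dvd p k a).resolve_right h⟩

theorem isUnit_two (h3 : 3 < p) : IsUnit (2 : ZMod (modulus p k)) :=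
  IsUnit.of_mul_eq_one _ (two_mul_inv p k h3)

/-- Elements congruent to one modulo `p` are squares. -/
theorem exists_sq_eq_one_add (h3 : 3 < p) (m : ZMod (modulus p k)) :
    ∃ w : ZMod (modulus p k), w ^ 2 = 1 + p * m := by
  -- Raising to the power `p^(2k)` turns a congruence to `1` mod `p` into one mod `p^(2k+1)`, that
  -- is, an equality in `ℤ_N`. So `1 + p m` has odd order dividing `p^(2k) = 2l + 1`, and its power
  -- `l + 1` is a square root.
  have h := dvd_sub_pow_of_dvd_sub (R := ZMod (modulus p k)) (p := p) (a := 1 + p * m) (b := 1)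
    ⟨m, by ring⟩ (2 * k)
  have h0 : (p : ZMod (modulus p k)) ^ (2 * k + 1) = 0 := by
    rw [pow_succ, two_mul, pow_add, pk_sq, zero_mul]
  rw [h0, zero_dvd_iff, one_pow, sub_eq_zero] at h
  have hodd : Odd (p ^ (2 * k)) := (hp.out.odd_of_ne_two (by omega)).pow
  obtain ⟨l, hl⟩ := hodd
  refine ⟨(1 + p * m) ^ (l + 1), ?_⟩
  rw [← pow_mul, show (l + 1) * 2 = p ^ (2 * k) + 1 by omega, pow_succ, h, one_mul]

/-- If neither `a - s` nor `a + s` were a unit, `p` would divide their difference, the unit `2s`. So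
one factor is a unit and `p^k` divides the other. -/
theorem pk_dvd_sub_or_add (h3 : 3 < p) (hk : 1 ≤ k) {a s : ZMod (modulus p k)} (hs : IsUnit s)
    (h : (p : ZMod (modulus p k)) ^ k ∣ a ^ 2 - s ^ 2) :
    (p : ZMod (modulus p k)) ^ k ∣ a - s ∨ (p : ZMod (modulus p k)) ^ k ∣ a + s := by
  rw [sq_sub_sq] at h
  by_cases h1 : IsUnit (a + s)
  · exact Or.inl ((h1.dvd_mul_left).1 h)
  by_cases h2 : IsUnit (a - s)
  · exact Or.inr ((h2.dvd_mul_right).1 h)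
  rw [isUnit_iff_not_dvd hk, not_not] at h1 h2
  have h4 : (p : ZMod (modulus p k)) ∣ 2 * s := by
    have := dvd_sub h1 h2
    rwa [show a + s - (a - s) = 2 * s by ring] at this
  exact absurd h4 ((isUnit_iff_not_dvd hk _).1 ((isUnit_two h3).mul hs))

/-- On a coset of `p ^ k ℤ_N`, a function in `V_C` is a combination of two plane waves. -/
theorem exists_two_waves (h3 : 3 < p) (hk : 1 ≤ k) {D : ZMod (modulus p k)} {C : ZMod (p ^ k)}
    {f : State p k} (hf : f ∈ VC p k D C) {s z : ZMod (modulus p k)} (hs : IsUnit s)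
    (hsz : red p k (s ^ 2 - D * z ^ 2) = -C) :
    ∃ u v : ℂ, ∀ y, (p : ZMod (modulus p k)) ^ k ∣ y - z → f y = u * e (s * y) + v * e (-(s * y)) := by
  induction hf using Submodule.span_induction with
  | mem f hf =>
    obtain ⟨x, hx, rfl⟩ := hf
    by_cases hxz : (p : ZMod (modulus p k)) ^ k ∣ z - x 1
    · have key : ∀ y, (p : ZMod (modulus p k)) ^ k ∣ y - z → zeta p k x y = e (x 0 * (y - x 1)) ∧
          ∃ c, y - x 1 = (p : ZMod (modulus p k)) ^ k * c := by
        intro y hy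
        have h := dvd_add hy hxz
        rw [sub_add_sub_cancel] at h
        exact ⟨by rw [zeta_apply, if_pos h], h⟩
      -- The second coordinates agree mod `p^k` and both norms reduce to `-C`, so the first
      -- coordinates have equal squares.
      have hsq : (p : ZMod (modulus p k)) ^ k ∣ x 0 ^ 2 - s ^ 2 := by
        rw [← red_eq_zero_iff] at hxz ⊢
        simp only [normForm, map_sub, map_mul, map_pow] at *
        rw [sub_eq_zero] at hxz
        rw [hxz] at hsz
        linear_combination hx - hsz
      -- Replacing `x 0` by `±s` changes the phase by a multiple of `p^k * p^k = 0`, since `y - x 1`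
      -- is itself divisible by `p^k`.
      rcases pk_dvd_sub_or_add h3 hk hs hsq with ⟨m, hm⟩ | ⟨m, hm⟩
      · refine ⟨e (-(s * x 1)), 0, fun y hy => ?_⟩
        obtain ⟨h1, c, hc⟩ := key y hy
        rw [h1, zero_mul, add_zero, ← e_add]
        congr 1
        linear_combination (y - x 1) * hm + (p : ZMod (modulus p k)) ^ k * m * hc +
          m * c * pk_sq p k
      · refine ⟨0, e (s * x 1), fun y hy => ?_⟩
        obtain ⟨h1, c, hc⟩ := key y hy
        rw [h1, zero_mul, zero_add, ← e_add]
        congr 1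
        linear_combination (y - x 1) * hm + (p : ZMod (modulus p k)) ^ k * m * hc +
          m * c * pk_sq p k
    · refine ⟨0, 0, fun y hy => ?_⟩
      rw [zeta_apply, if_neg]
      · simp
      · intro h
        have := dvd_sub h hy
        rw [sub_sub_sub_cancel_left] at this
        exact hxz this
  | zero => exact ⟨0, 0, by simp⟩
  | add f g _ _ hf hg =>
    obtain ⟨u, v, h⟩ := hf
    obtain ⟨u', v', h'⟩ := hg
    refine ⟨u + u', v + v', fun y hy => ?_⟩
    rw [Pi.add_apply, h y hy, h' y hy]; ring
  | smul c f _ hf =>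
    obtain ⟨u, v, h⟩ := hf
    refine ⟨c * u, c * v, fun y hy => ?_⟩
    rw [Pi.smul_apply, smul_eq_mul, h y hy]; ring

/-! ### The Weil representation: action on `eta` and unitarity -/

/-- The property is multiplicative in `g`, so the generators suffice. The symmetric phase in `eta`
makes the action free of scalar factors. -/
theorem weilRep_eta (h3 : 3 < p) (g : SL2 p k) (x : Fin 2 → ZMod (modulus p k)) :
    weilRep p k h3 g (eta p k x) = eta p k (g.1.mulVec x) := by
  have hU := weilRep_spec p k h3
  refine gen_induction p k (P := fun B => Moves p k B (weilRep p k h3 B)) ?_ ?_ ?_ ?_ g x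
  · intro b x
    rw [← moves_n p k h3 b x]
    ext z
    exact hU.nMat_apply b _ z
  · intro t x
    rw [← moves_a p k t x]
    ext z
    exact hU.aMat_apply t _ z
  · intro x
    rw [← moves_w p k h3 x]
    ext z
    exact hU.wMat_apply _ z
  · intro A B hA hB
    rw [map_mul]
    exact moves_mul p k hA hB

/-- Parseval's identity for the discrete Fourier transform. -/
theorem sum_fourier_mul_conj {n : ℕ} [NeZero n] (f g : ZMod n → ℂ) :
    ∑ x, (∑ y, f y * e (x * y)) * (starRingEnd ℂ) (∑ y, g y * e (x * y)) =
      n * ∑ y, f y * (starRingEnd ℂ) (g y) := by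
  have h : ∀ x, (∑ y, f y * e (x * y)) * (starRingEnd ℂ) (∑ y, g y * e (x * y)) =
      ∑ y, ∑ y', f y * (starRingEnd ℂ) (g y') * e (x * (y - y')) := by
    intro x
    rw [map_sum, Finset.sum_mul_sum]
    refine Finset.sum_congr rfl fun y _ => Finset.sum_congr rfl fun y' _ => ?_
    rw [map_mul, ← e_neg, mul_sub, sub_eq_add_neg, e_add]; ring
  simp only [h]
  rw [Finset.sum_comm, Finset.mul_sum]
  refine Finset.sum_congr rfl fun y _ => ?_
  rw [Finset.sum_comm, Finset.sum_eq_single y]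
  · rw [← Finset.mul_sum, sum_e_mul]; simp [mul_comm]
  · intro y' _ hy
    rw [← Finset.mul_sum, sum_e_mul, if_neg (sub_ne_zero.2 hy.symm), mul_zero]
  · simp

/-- The Weil representation is unitary. -/
theorem weilRep_unitary (h3 : 3 < p) (g : SL2 p k) (f h : State p k) :
    ∑ x, weilRep p k h3 g f x * (starRingEnd ℂ) (weilRep p k h3 g h x) =
      ∑ x, f x * (starRingEnd ℂ) (h x) := by
  have hU := weilRep_spec p k h3
  refine gen_induction p k (P := fun g => ∀ f h : State p k,
    ∑ x, weilRep p k h3 g f x * (starRingEnd ℂ) (weilRep p k h3 g h x) =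
      ∑ x, f x * (starRingEnd ℂ) (h x)) ?_ ?_ ?_ ?_ g f h
  · intro b f h
    refine Finset.sum_congr rfl fun x _ => ?_
    rw [hU.nMat_apply, hU.nMat_apply, map_mul]
    linear_combination f x * (starRingEnd ℂ) (h x) *
      e_mul_conj ((2 : ZMod (modulus p k))⁻¹ * b * x ^ 2)
  · intro t f h
    simp only [hU.aMat_apply]
    exact Equiv.sum_comp (Units.mulLeft t) fun x => f x * (starRingEnd ℂ) (h x)
  · intro f h
    simp only [hU.wMat_apply, two_mul_inv p k h3, one_mul, map_mul]
    have hN : (modulus p k : ℂ) ≠ 0 := by exact_mod_cast NeZero.ne (modulus p k)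
    have hsq : (Real.sqrt (modulus p k : ℝ) : ℂ) * (Real.sqrt (modulus p k : ℝ) : ℂ) =
        (modulus p k : ℂ) := by
      rw [← Complex.ofReal_mul, Real.mul_self_sqrt (Nat.cast_nonneg _), Complex.ofReal_natCast]
    have hc : (starRingEnd ℂ) (1 / (Real.sqrt (modulus p k : ℝ) : ℂ)) =
        1 / (Real.sqrt (modulus p k : ℝ) : ℂ) := by
      rw [map_div₀, map_one, Complex.conj_ofReal]
    rw [hc]
    simp only [mul_mul_mul_comm (1 / (Real.sqrt (modulus p k : ℝ) : ℂ))]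
    rw [← Finset.mul_sum, sum_fourier_mul_conj, div_mul_div_comm, hsq]
    field_simp
  · intro A B hA hB f h
    rw [map_mul]
    simp only [Module.End.mul_apply]
    rw [hA, hB]

end QuantumCat

namespace QuantumCat

/-! ### Norm identities and alignment of two phases -/

theorem sum_mul_conj_eq {n : ℕ} [NeZero n] (f : ZMod n → ℂ) :
    ∑ x, f x * (starRingEnd ℂ) (f x) = ((∑ x, ‖f x‖ ^ 2 : ℝ) : ℂ) := by
  push_cast
  exact Finset.sum_congr rfl fun x _ => Complex.mul_conj' (f x)

theorem sum_norm_sq_eq_of_l2Norm_eq_one {n : ℕ} [NeZero n] {f : ZMod n → ℂ} (h : l2Norm f = 1) :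
    ∑ x, ‖f x‖ ^ 2 = (n : ℝ) := by
  have hn : (n : ℝ) ≠ 0 := by exact_mod_cast NeZero.ne n
  rw [l2Norm, Real.sqrt_eq_one, l2Inner, sum_mul_conj_eq] at h
  have h1 : (1 / (n : ℂ)) * ((∑ x, ‖f x‖ ^ 2 : ℝ) : ℂ) =
      ((1 / (n : ℝ) * ∑ x, ‖f x‖ ^ 2 : ℝ) : ℂ) := by push_cast; rfl
  rw [h1, Complex.ofReal_re] at h
  field_simp at h
  exact h

theorem norm_mul_e_add_sq (u v : ℂ) {n : ℕ} [NeZero n] (a b : ZMod n) :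
    ((‖u * e a + v * e b‖ ^ 2 : ℝ) : ℂ) = ‖u‖ ^ 2 + ‖v‖ ^ 2 +
      (u * (starRingEnd ℂ) v * e (a - b) + v * (starRingEnd ℂ) u * e (b - a)) := by
  push_cast
  rw [← Complex.mul_conj', ← Complex.mul_conj', ← Complex.mul_conj', map_add, map_mul, map_mul,
    sub_eq_add_neg, sub_eq_add_neg, e_add, e_add, e_neg, e_neg]
  linear_combination u * (starRingEnd ℂ) u * e_mul_conj a + v * (starRingEnd ℂ) v * e_mul_conj b

/-- Some `M`-th root of unity rotates `w` to within angle `π / M` of `1`. If the remaining angle is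
`2δ`, the sum has modulus `2 |cos δ|`, and `cos δ ≥ 1 - δ² / 2`. -/
theorem exists_norm_mul_exp_add_one {M : ℕ} (hM : M ≠ 0) {w : ℂ} (hw : ‖w‖ = 1) :
    ∃ j : ℤ, 2 * (1 - Real.pi ^ 2 / (8 * (M : ℝ) ^ 2)) ≤
      ‖w * Complex.exp (2 * Real.pi * Complex.I * j / M) + 1‖ := by
  obtain ⟨θ, rfl⟩ := (Complex.norm_eq_one_iff w).1 hw
  have hM' : (0 : ℝ) < M := by exact_mod_cast Nat.pos_of_ne_zero hM
  have hMc : (M : ℂ) ≠ 0 := by exact_mod_cast hM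
  set m := round (θ * M / (2 * Real.pi)) with hm
  have h := abs_sub_round (θ * M / (2 * Real.pi))
  rw [← hm] at h
  set d : ℝ := θ * M / (2 * Real.pi) - m with hd
  set δ : ℝ := Real.pi * d / M with hδ
  -- `δ` is half of the rounding error of the angle, whence `|δ| ≤ π / (2M)`.
  have hθ : θ = 2 * δ + 2 * Real.pi * m / M := by
    rw [hδ, hd]; field_simp; ring
  refine ⟨-m, ?_⟩
  have h1 : Complex.exp (θ * Complex.I) *
      Complex.exp (2 * Real.pi * Complex.I * ((-m : ℤ) : ℂ) / M) + 1 =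
      Complex.exp (δ * Complex.I) * (2 * Complex.cos δ) := by
    rw [Complex.two_cos, mul_add, ← Complex.exp_add, ← Complex.exp_add, ← Complex.exp_add]
    congr 1
    · congr 1
      rw [hθ]; push_cast; field_simp; ring
    · rw [← Complex.exp_zero]; congr 1; ring
  rw [h1, norm_mul, Complex.norm_exp_ofReal_mul_I, one_mul, norm_mul, ← Complex.ofReal_cos,
    Complex.norm_real, Complex.norm_ofNat]
  have h2 : δ ^ 2 ≤ Real.pi ^ 2 / (4 * (M : ℝ) ^ 2) := by
    have h3 : d ^ 2 ≤ (1 / 2) ^ 2 := sq_le_sq' (neg_le_of_abs_le h) (le_of_abs_le h)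
    rw [hδ, div_pow, mul_pow, div_le_div_iff₀ (by positivity) (by positivity)]
    have : 0 ≤ Real.pi ^ 2 * (M : ℝ) ^ 2 := by positivity
    nlinarith
  have h4 : 1 - δ ^ 2 / 2 ≤ Real.cos δ := Real.one_sub_sq_div_two_le_cos
  have h5 : Real.pi ^ 2 / (8 * (M : ℝ) ^ 2) = Real.pi ^ 2 / (4 * (M : ℝ) ^ 2) / 2 := by
    field_simp; norm_num
  have h6 := le_abs_self (Real.cos δ)
  rw [Real.norm_eq_abs]
  linarith

/-! ### Hecke orbits and equality of amplitudes -/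

/-- `H_D` acts transitively on the vectors whose norm is a given unit. -/
theorem exists_heckeGroup_mulVec {p k : ℕ} {D x₀ x₁ y₀ y₁ n : ZMod (modulus p k)} (hn : IsUnit n)
    (hx : x₀ ^ 2 - D * x₁ ^ 2 = n) (hy : y₀ ^ 2 - D * y₁ ^ 2 = n) :
    ∃ g ∈ heckeGroup p k D, g.1.mulVec ![x₀, x₁] = ![y₀, y₁] := by
  obtain ⟨m, hm⟩ := hn.exists_right_inv
  -- Identify `(x₀, x₁)` with `x₀ + x₁ √D`. Then `H_D` acts by multiplication by norm-one elements,
  -- and `a + b √D` is the quotient `y / x`, computed as `y` times the conjugate of `x`, divided by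
  -- `n`.
  set a := m * (y₀ * x₀ - D * y₁ * x₁) with ha
  set b := m * (y₁ * x₀ - y₀ * x₁) with hb
  have hab : a ^ 2 - D * b ^ 2 = 1 := by
    rw [ha, hb]
    linear_combination m ^ 2 * (y₀ ^ 2 - D * y₁ ^ 2) * hx + m ^ 2 * n * hy + (n * m + 1) * hm
  refine ⟨⟨!![a, b * D; b, a], by rw [Matrix.det_fin_two_of]; linear_combination hab⟩,
    ⟨a, b, hab, rfl⟩, ?_⟩
  ext i
  fin_cases i
  · simp [Matrix.mulVec, dotProduct, Fin.sum_univ_two]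
    rw [ha, hb]
    linear_combination m * y₀ * hx + y₀ * hm
  · simp [Matrix.mulVec, dotProduct, Fin.sum_univ_two]
    rw [ha, hb]
    linear_combination m * y₁ * hx + y₁ * hm

variable {p k : ℕ} [hp : Fact p.Prime]

/-- The pairing of a state with `eta x`. -/
noncomputable def etaCoeff (f : State p k) (x : Fin 2 → ZMod (modulus p k)) : ℂ :=
  ∑ w, f w * (starRingEnd ℂ) (eta p k x w)

theorem not_pk_dvd (hk : 1 ≤ k) {a : ZMod (modulus p k)} (ha : IsUnit a) :
    ¬ (p : ZMod (modulus p k)) ^ k ∣ a := fun h =>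
  (isUnit_iff_not_dvd hk a).1 ha ((dvd_pow_self _ (by omega)).trans h)

/-- The wave of frequency `s` contributes `u` at each of the `p^k` points of the coset. The other
gives a character sum of frequency `-2s`, which vanishes because `2s` is a unit. -/
theorem norm_etaCoeff (h3 : 3 < p) (hk : 1 ≤ k) {f : State p k} {s z : ZMod (modulus p k)}
    (hs : IsUnit s) {u v : ℂ}
    (h : ∀ y, (p : ZMod (modulus p k)) ^ k ∣ y - z → f y = u * e (s * y) + v * e (-(s * y))) :
    ‖etaCoeff f ![s, z]‖ = (p : ℝ) ^ k * ‖u‖ := by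
  classical
  have key : etaCoeff f ![s, z] = e ((2 : ZMod (modulus p k))⁻¹ * s * z) * (p ^ k * u) := by
    have hterm : ∀ w, f w * (starRingEnd ℂ) (eta p k ![s, z] w) =
        e ((2 : ZMod (modulus p k))⁻¹ * s * z) *
          (u * (if (p : ZMod (modulus p k)) ^ k ∣ w - z then 1 else 0) +
           v * (if (p : ZMod (modulus p k)) ^ k ∣ w - z then e (-(2 * s) * w) else 0)) := by
      intro w
      simp only [eta, Matrix.cons_val_zero, Matrix.cons_val_one, Matrix.cons_val_fin_one]
      split_ifs with hw
      · have h1 := e_mul_conj (s * w)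
        have h2 : e (-(2 * s) * w) = (starRingEnd ℂ) (e (s * w)) * (starRingEnd ℂ) (e (s * w)) := by
          rw [← e_neg, ← e_add]; congr 1; ring
        rw [h w hw, ← e_neg, h2, neg_sub, sub_eq_add_neg, e_add, e_neg]
        linear_combination e ((2 : ZMod (modulus p k))⁻¹ * s * z) * u * h1
      · simp
    rw [etaCoeff, Finset.sum_congr rfl fun w _ => hterm w, ← Finset.mul_sum,
      Finset.sum_add_distrib, ← Finset.mul_sum, ← Finset.mul_sum, card_mult, char_sum,
      if_neg (not_pk_dvd hk ((isUnit_two h3).mul hs).neg)]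
    ring
  rw [key, norm_mul, norm_e, one_mul, norm_mul, norm_pow, Complex.norm_natCast]

theorem norm_eigenvalue (h3 : 3 < p) {ψ : State p k} (h0 : ψ ≠ 0) {g : SL2 p k} {μ : ℂ}
    (h : weilRep p k h3 g ψ = μ • ψ) : ‖μ‖ = 1 := by
  have h1 := weilRep_unitary h3 g ψ ψ
  rw [sum_mul_conj_eq, sum_mul_conj_eq, h, Complex.ofReal_inj] at h1
  simp only [Pi.smul_apply, norm_smul, mul_pow, ← Finset.mul_sum] at h1
  have hpos : (∑ x, ‖ψ x‖ ^ 2) ≠ 0 := by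
    intro hs
    apply h0
    ext x
    have := (Finset.sum_eq_zero_iff_of_nonneg fun i _ => by positivity).1 hs x (Finset.mem_univ x)
    simpa using this
  have h2 : ‖μ‖ ^ 2 = 1 := mul_right_cancel₀ hpos (by rw [h1, one_mul])
  exact (pow_eq_one_iff_of_nonneg (norm_nonneg μ) two_ne_zero).1 h2

/-- Unitarity moves `g` from `eta` onto `ψ`, where it acts by a scalar of modulus one. -/
theorem norm_etaCoeff_eq (h3 : 3 < p) {D x₀ x₁ y₀ y₁ n : ZMod (modulus p k)} {ψ : State p k}
    (hψ : IsHeckeEigenfunction p k h3 D ψ) (hn : IsUnit n)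
    (hx : x₀ ^ 2 - D * x₁ ^ 2 = n) (hy : y₀ ^ 2 - D * y₁ ^ 2 = n) :
    ‖etaCoeff ψ ![x₀, x₁]‖ = ‖etaCoeff ψ ![y₀, y₁]‖ := by
  obtain ⟨g, hg, hgx⟩ := exists_heckeGroup_mulVec hn hx hy
  obtain ⟨μ, hμ⟩ := hψ.2 g hg
  have h := weilRep_unitary h3 g ψ (eta p k ![x₀, x₁])
  rw [weilRep_eta, hgx, hμ] at h
  have h' : etaCoeff ψ ![x₀, x₁] = μ * etaCoeff ψ ![y₀, y₁] := by
    rw [etaCoeff, ← h, etaCoeff, Finset.mul_sum]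
    refine Finset.sum_congr rfl fun w _ => ?_
    rw [Pi.smul_apply, smul_eq_mul, mul_assoc]
  rw [h', norm_mul, norm_eigenvalue h3 hψ.1 hμ, one_mul]

/-- A Hecke eigenfunction in `V_C` is, on each coset of `p ^ k ℤ_N`, a sum of two plane waves whose
amplitudes have the same absolute value, independent of the coset. -/
theorem exists_two_waves_eigenfunction (h3 : 3 < p) (hk : 1 ≤ k) {D : ZMod (modulus p k)}
    (hD : (p : ZMod (modulus p k)) ∣ D) {C : ZMod (p ^ k)} (hC : IsUnit C) {ψ : State p k}
    (hψ : IsHeckeEigenfunction p k h3 D ψ) (hψC : ψ ∈ VC p k D C) :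
    ∃ γ : ℝ, ∀ z, ∃ s : ZMod (modulus p k), IsUnit s ∧ ∃ u v : ℂ, ‖u‖ = γ ∧ ‖v‖ = γ ∧
      ∀ y, (p : ZMod (modulus p k)) ^ k ∣ y - z → ψ y = u * e (s * y) + v * e (-(s * y)) := by
  -- Without a solution `V_C` would be zero, contradicting `ψ ≠ 0`.
  have hx : ∃ x : Fin 2 → ZMod (modulus p k), normForm p k D (fun i => red p k (x i)) = -C := by
    by_contra hne
    push Not at hne
    apply hψ.1
    have : VC p k D C = ⊥ := by
      rw [VC, Submodule.span_eq_bot]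
      rintro f ⟨x, hx, -⟩
      exact absurd hx (hne x)
    rw [this] at hψC
    exact (Submodule.mem_bot ℂ).1 hψC
  obtain ⟨x, hx⟩ := hx
  obtain ⟨D', rfl⟩ := hD
  set n := x 0 ^ 2 - p * D' * x 1 ^ 2 with hndef
  have hnC : red p k n = -C := by
    rw [← hx, normForm]; simp [hndef]
  have hn : IsUnit n := by
    rcases isUnit_or_dvd p k n with h | ⟨c, hc⟩
    · exact h
    · have h1 : IsUnit (-C) := hC.neg
      rw [← hnC, hc, map_mul, map_natCast] at h1
      have h2 := isUnit_of_mul_isUnit_left h1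
      rw [ZMod.isUnit_iff_coprime] at h2
      have := Nat.Coprime.coprime_dvd_right (dvd_pow_self p (by omega : k ≠ 0)) h2
      rw [Nat.coprime_self] at this
      exact absurd this hp.out.one_lt.ne'
  have hx0 : IsUnit (x 0) := by
    rw [isUnit_iff_not_dvd hk] at hn ⊢
    intro h
    apply hn
    rw [hndef, mul_assoc]
    exact dvd_sub (dvd_pow h two_ne_zero) ⟨_, rfl⟩
  obtain ⟨i, hi⟩ := hx0.exists_right_inv
  have hpk : (p : ℝ) ^ k ≠ 0 := pow_ne_zero _ (by exact_mod_cast hp.out.ne_zero)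
  refine ⟨‖etaCoeff ψ ![x 0, x 1]‖ / (p : ℝ) ^ k, fun z => ?_⟩
  -- Solving `s² - D z² = n` with `s = x 0 * w` requires `w² = 1 + D (z² - x 1 ^ 2) / x 0 ^ 2`,
  -- which is `1` mod `p` since `p ∣ D`. Equality must hold in `ℤ_N`, not just mod `p^k`, for `H_D`
  -- to carry one vector to the other.
  obtain ⟨w, hw⟩ := exists_sq_eq_one_add h3 (i ^ 2 * D' * (z ^ 2 - x 1 ^ 2))
  have hs : (x 0 * w) ^ 2 - p * D' * z ^ 2 = n := by
    rw [hndef]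
    linear_combination x 0 ^ 2 * hw + p * D' * (z ^ 2 - x 1 ^ 2) * (x 0 * i + 1) * hi
  have hsu : IsUnit (x 0 * w) := by
    rw [isUnit_iff_not_dvd hk] at hn ⊢
    intro h
    apply hn
    rw [← hs, mul_assoc (p : ZMod (modulus p k))]
    exact dvd_sub (dvd_pow h two_ne_zero) ⟨_, rfl⟩
  obtain ⟨u, v, huv⟩ := exists_two_waves h3 hk hψC hsu (hs ▸ hnC)
  refine ⟨x 0 * w, hsu, u, v, ?_, ?_, huv⟩
  · rw [norm_etaCoeff_eq h3 hψ hn hndef.symm hs, norm_etaCoeff h3 hk hsu huv]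
    field_simp
  -- The amplitude `v` belongs to the vector `(-s, z)`, which has the same norm `n`.
  · have hs' : (-(x 0 * w)) ^ 2 - p * D' * z ^ 2 = n := by rw [neg_sq]; exact hs
    rw [norm_etaCoeff_eq h3 hψ hn hndef.symm hs', norm_etaCoeff h3 hk hsu.neg (u := v) (v := u)]
    · field_simp
    · intro y hy
      rw [huv y hy, neg_mul, neg_neg, add_comm]

/-! ### The value of the amplitude and the lower bound -/

/-- The amplitudes of the plane waves of a normalized eigenfunction. -/
theorem two_mul_amplitude_sq (h3 : 3 < p) (hk : 1 ≤ k) {ψ : State p k} (hnorm : l2Norm ψ = 1)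
    {γ : ℝ} (h : ∀ z, ∃ s : ZMod (modulus p k), IsUnit s ∧ ∃ u v : ℂ, ‖u‖ = γ ∧ ‖v‖ = γ ∧
      ∀ y, (p : ZMod (modulus p k)) ^ k ∣ y - z → ψ y = u * e (s * y) + v * e (-(s * y))) :
    2 * γ ^ 2 = 1 := by
  set q := (p : ZMod (modulus p k)) ^ k with hq
  have hN : (modulus p k : ℝ) ≠ 0 := by exact_mod_cast NeZero.ne (modulus p k)
  -- Letting `t` run over all of `ℤ_N` merely repeats each coset point equally often. The cross
  -- terms are sums of nontrivial characters of `t`, as `p^k * 2s ≠ 0`.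
  have hcoset : ∀ z, ∑ t : ZMod (modulus p k), ‖ψ (z + q * t)‖ ^ 2 =
      (modulus p k : ℝ) * (2 * γ ^ 2) := by
    intro z
    obtain ⟨s, hs, u, v, hu, hv, huv⟩ := h z
    have hne : ∀ a : ZMod (modulus p k), IsUnit a → q * a ≠ 0 := fun a ha h0 =>
      not_pk_dvd hk ha ((pk_mul_eq_zero_iff a).1 h0)
    have hterm : ∀ t : ZMod (modulus p k), ((‖ψ (z + q * t)‖ ^ 2 : ℝ) : ℂ) = 2 * γ ^ 2 +
        (u * (starRingEnd ℂ) v * e (2 * s * z) * e (t * (q * (2 * s))) +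
          v * (starRingEnd ℂ) u * e (-(2 * s) * z) * e (t * (q * -(2 * s)))) := by
      intro t
      rw [huv _ ⟨t, by ring⟩, norm_mul_e_add_sq, hu, hv,
        mul_assoc (u * _), mul_assoc (v * _), ← e_add, ← e_add]
      ring_nf
    rw [← Complex.ofReal_inj]
    push_cast only [Complex.ofReal_sum]
    simp only [hterm]
    rw [Finset.sum_add_distrib, Finset.sum_add_distrib, ← Finset.mul_sum Finset.univ (fun t => e _),
      ← Finset.mul_sum Finset.univ (fun t => e _), sum_e_mul, sum_e_mul, if_neg (hne _ ((isUnit_two h3).mul hs)),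
      if_neg (hne _ ((isUnit_two h3).mul hs).neg)]
    simp
  -- For fixed `t` the translate `z + q t` runs over all of `ℤ_N`, so normalization applies to each
  -- inner sum after the exchange.
  have hsum : ∑ z : ZMod (modulus p k), ∑ t : ZMod (modulus p k), ‖ψ (z + q * t)‖ ^ 2 =
      (modulus p k : ℝ) * (modulus p k : ℝ) := by
    have htrans : ∀ t, ∑ z, ‖ψ (z + q * t)‖ ^ 2 = (modulus p k : ℝ) := fun t =>
      (Equiv.sum_comp (Equiv.addRight (q * t)) fun z => ‖ψ z‖ ^ 2).trans
        (sum_norm_sq_eq_of_l2Norm_eq_one hnorm)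
    rw [Finset.sum_comm]
    simp [htrans]
  simp only [hcoset, Finset.sum_const, Finset.card_univ, ZMod.card, nsmul_eq_mul] at hsum
  exact mul_left_cancel₀ hN (mul_left_cancel₀ hN (by rw [hsum, mul_one]))

/-- For `y = p^k c / (2s)` the quotient of the two exponentials is `e(c / p^k)`, an arbitrary
`p^k`-th root of unity. The alignment estimate with `M = p^k` gives the constant, as `M² = N`. -/
theorem exists_le_norm_two_waves (h3 : 3 < p) {s : ZMod (modulus p k)} (hs : IsUnit s) {u v : ℂ}
    {γ : ℝ} (hγ : 0 < γ) (hu : ‖u‖ = γ) (hv : ‖v‖ = γ) :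
    ∃ y, (p : ZMod (modulus p k)) ^ k ∣ y ∧
      2 * γ * (1 - Real.pi ^ 2 / (8 * (modulus p k : ℝ))) ≤
        ‖u * e (s * y) + v * e (-(s * y))‖ := by
  have hv0 : v ≠ 0 := norm_ne_zero_iff.1 (by rw [hv]; exact hγ.ne')
  have hw : ‖u / v‖ = 1 := by rw [norm_div, hu, hv, div_self hγ.ne']
  obtain ⟨j, hj⟩ := exists_norm_mul_exp_add_one (pow_ne_zero k hp.out.ne_zero) hw
  obtain ⟨i, hi⟩ := ((isUnit_two h3).mul hs).exists_right_inv
  set q := (p : ZMod (modulus p k)) ^ k with hq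
  set c : ZMod (modulus p k) := (j : ZMod (modulus p k)) with hc
  have hej : e (q * c) =
      Complex.exp (2 * Real.pi * Complex.I * j / ((p ^ k : ℕ) : ℂ)) := by
    rw [hq, hc, e_pk_mul, map_intCast, e, ZMod.stdAddChar_coe]
  have hN : (modulus p k : ℝ) = ((p ^ k : ℕ) : ℝ) ^ 2 := by push_cast [modulus]; ring
  refine ⟨q * (i * c), ⟨_, rfl⟩, ?_⟩
  have h1 : u * e (s * (q * (i * c))) + v * e (-(s * (q * (i * c)))) =
      v * e (-(s * (q * (i * c)))) * (u / v * e (q * c) + 1) := by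
    have h2 : e (s * (q * (i * c))) = e (-(s * (q * (i * c)))) * e (q * c) := by
      rw [← e_add]; congr 1
      linear_combination q * c * hi
    rw [h2]
    field_simp
  rw [h1, norm_mul, norm_mul, norm_e, mul_one, hv, hej, hN]
  calc _ = γ * (2 * (1 - Real.pi ^ 2 / (8 * ((p ^ k : ℕ) : ℝ) ^ 2))) := by ring
    _ ≤ _ := mul_le_mul_of_nonneg_left hj hγ.le

end QuantumCat

theorem mainTheorem12 (p k : ℕ) [Fact p.Prime] (hp : 3 < p) (hk : 1 ≤ k)
    (D : ZMod (QuantumCat.modulus p k)) (hD : (p : ZMod (QuantumCat.modulus p k)) ∣ D)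
    (C : ZMod (p ^ k)) (hC : IsUnit C)
    (ψ : QuantumCat.State p k) (hψ : QuantumCat.IsHeckeEigenfunction p k hp D ψ)
    (hψC : ψ ∈ QuantumCat.VC p k D C) (hnorm : QuantumCat.l2Norm ψ = 1) :
    Real.sqrt 2 * (1 - Real.pi ^ 2 / (8 * (QuantumCat.modulus p k : ℝ))) ≤ QuantumCat.supNorm ψ ∧
      QuantumCat.supNorm ψ ≤ Real.sqrt 2 := by
  obtain ⟨γ, h⟩ := QuantumCat.exists_two_waves_eigenfunction hp hk hD hC hψ hψC
  have hγ := QuantumCat.two_mul_amplitude_sq hp hk hnorm h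
  have hγ0 : 0 ≤ γ := by
    obtain ⟨-, -, u, -, hu, -⟩ := h 0
    exact hu ▸ norm_nonneg u
  have hsqrt : Real.sqrt 2 = 2 * γ := by
    rw [Real.sqrt_eq_iff_mul_self_eq (by norm_num) (by positivity)]
    linear_combination -2 * hγ
  constructor
  · obtain ⟨s, hs, u, v, hu, hv, huv⟩ := h 0
    have hγpos : 0 < γ := lt_of_le_of_ne hγ0 fun h0 => by simp [← h0] at hγ
    obtain ⟨y, hy, hle⟩ := QuantumCat.exists_le_norm_two_waves hp hs hγpos hu hv
    rw [hsqrt, QuantumCat.supNorm]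
    rw [← huv y (by rwa [sub_zero])] at hle
    exact hle.trans (le_ciSup (f := fun x => ‖ψ x‖) (Set.finite_range _).bddAbove y)
  · rw [QuantumCat.supNorm]
    refine ciSup_le fun z => ?_
    obtain ⟨s, hs, u, v, hu, hv, huv⟩ := h z
    rw [huv z (by simp)]
    refine (norm_add_le _ _).trans ?_
    rw [norm_mul, norm_mul, QuantumCat.norm_e, QuantumCat.norm_e, hu, hv, hsqrt]
    linarith
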